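/- Let $s\ge 0$ and $n\ge 1$ be integers, and let $\tilde a_i\in\mathbb C$ and $a_i(\nu)\in\mathbb C$ ($0\le i\le n$, $\nu=0,1,2,\dots$) satisfy $a_n(\nu)=1$ for all $\nu$ and $a_i(\nu)-\tilde a_i=O(1/(\nu+1))$ for $0\le i\le n$. Let $T(z)=\sum_{i=0}^n\tilde a_i z^i$. Let $\rho_1>\rho_2>\dots>\rho_{s+1}=0$ be real numbers such that the absolute value of every root of $T$ is one of the $\rho_i$. For $1\le i\le s$ let $e_i$ and $k_i$ be the sum and the maximum of the multiplicities of the roots of $T$ of absolute value $\rho_i$, suppose that $e_i>0$ for $1\le i\le s$, and let $k=\max(k_1,\dots,k_s)$. For an integer $m\ge 1$ let $V_m$ be the complex vector space of the sequences $y=(y(\nu))_{\nu\ge m}$ of complex numbers with $\sum_{i=0}^n a_i(\nu)\,y(\nu+i)=0$ for all $\nu\ge m$; for $1\le j\le s+1$ let $V_{m,j}^\wedge=\{y\in V_m:\ \limsup_{\nu\to\infty}|y(\nu)|^{1/\nu}\le\rho_j\}$, which is a linear subspace of $V_m$; and let $\omega_{n,y}(\nu)=\max(|y(\nu)|,\dots,|y(\nu+n-1)|)$.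 Then for every integer $m\ge1$, every $\theta\in\{1,\dots,s\}$ and every linear subspace $V$ of $V_m$ with $V\cap V_{m,\theta+1}^\wedge=\{0\}$ there is a constant $A^*=A^*(V)>0$ such that, for all $y\in V$ and all integers $\nu\ge m$, $$\omega_{n,y}(\nu)\ \ge\ \exp\bigl(-A^*(\ln\nu+\nu^{1-1/k})\bigr)\,\rho_\theta^{\,\nu}\,\omega_{n,y}(m).$$ -/

import Mathlib

open Filter Topology
open scoped ENNReal

namespace PoincareDifference

/-- The index `ν + k`, for `ν ∈ {m, m + 1, …}`. -/
def shift {m : ℕ} (ν : Set.Ici m) (k : ℕ) : Set.Ici m :=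
  ⟨ν.1 + k, le_trans ν.2 (Nat.le_add_right _ _)⟩

/-- The space `V_m` of the sequences `y(m), y(m+1), …` of complex numbers that satisfy
`∑_{k=0}^n a_k(ν) y(ν+k) = 0` for every `ν ≥ m`. -/
def solutionSpace {n : ℕ} (a : Fin (n + 1) → ℕ → ℂ) (m : ℕ) :
    Submodule ℂ (Set.Ici m → ℂ) where
  carrier := {y | ∀ ν : Set.Ici m, ∑ k : Fin (n + 1), a k ν.1 * y (shift ν k) = 0}
  zero_mem' := by intro ν; simp
  add_mem' := by
    intro x y hx hy ν
    have h1 := hx ν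
    have h2 := hy ν
    simp only [Pi.add_apply, mul_add, Finset.sum_add_distrib, h1, h2, add_zero]
  smul_mem' := by
    intro c y hy ν
    have h1 := hy ν
    simp only [Pi.smul_apply, smul_eq_mul, mul_left_comm _ c, ← Finset.mul_sum, h1, mul_zero]

/-- `limsup_{ν → ∞} |y(ν)|^{1/ν}`, an element of `[0, ∞]`. -/
noncomputable def growthRate {m : ℕ} (y : Set.Ici m → ℂ) : ℝ≥0∞ :=
  limsup (fun ν : Set.Ici m => ‖y ν‖ₑ ^ (1 / (ν.1 : ℝ))) atTop

theorem tendsto_coe_Ici (m : ℕ) : Tendsto (fun ν : Set.Ici m => ν.1) atTop atTop :=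
  tendsto_atTop_atTop.2 fun b => ⟨⟨max m b, Set.mem_Ici.2 (le_max_left m b)⟩, fun ν hν =>
    le_trans (le_max_right m b) hν⟩

/-- A sequence dominated by a constant times the maximum of two sequences does not grow faster
than the two. -/
theorem growthRate_le_of_le {m : ℕ} {x y z : Set.Ici m → ℂ} {C L : ℝ≥0∞} (hC0 : C ≠ 0)
    (hC : C ≠ ∞) (h : ∀ ν, ‖z ν‖ₑ ≤ C * max ‖x ν‖ₑ ‖y ν‖ₑ)
    (hx : growthRate x ≤ L) (hy : growthRate y ≤ L) : growthRate z ≤ L := by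
  refine le_of_forall_gt_imp_ge_of_dense fun r hr => ?_
  have hx' := eventually_lt_of_limsup_lt (lt_of_le_of_lt hx hr)
  have hy' := eventually_lt_of_limsup_lt (lt_of_le_of_lt hy hr)
  have hlim : Tendsto (fun ν : Set.Ici m => C ^ (1 / (ν.1 : ℝ)) * r) atTop (𝓝 (1 * r)) := by
    refine ENNReal.Tendsto.mul_const ?_ (Or.inl one_ne_zero)
    have h0 : Tendsto (fun ν : Set.Ici m => 1 / (ν.1 : ℝ)) atTop (𝓝 0) :=
      tendsto_one_div_atTop_nhds_zero_nat.comp (tendsto_coe_Ici m)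
    lift C to NNReal using hC
    have hC1 : C ≠ 0 := by exact_mod_cast hC0
    have h1 : Tendsto (fun ν : Set.Ici m => C ^ (1 / (ν.1 : ℝ))) atTop (𝓝 (C ^ (0 : ℝ))) :=
      tendsto_const_nhds.nnrpow h0 (Or.inl hC1)
    rw [NNReal.rpow_zero] at h1
    have h2 := ENNReal.tendsto_coe.2 h1
    simpa [ENNReal.coe_rpow_of_ne_zero hC1] using h2
  rw [one_mul] at hlim
  rw [← hlim.limsup_eq]
  refine limsup_le_limsup ?_
  filter_upwards [hx', hy'] with ν h1 h2
  have hp : (0 : ℝ) ≤ 1 / (ν.1 : ℝ) := by positivity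
  calc ‖z ν‖ₑ ^ (1 / (ν.1 : ℝ))
      ≤ (C * max ‖x ν‖ₑ ‖y ν‖ₑ) ^ (1 / (ν.1 : ℝ)) := ENNReal.rpow_le_rpow (h ν) hp
    _ = C ^ (1 / (ν.1 : ℝ)) * (max ‖x ν‖ₑ ‖y ν‖ₑ) ^ (1 / (ν.1 : ℝ)) :=
        ENNReal.mul_rpow_of_nonneg _ _ hp
    _ ≤ C ^ (1 / (ν.1 : ℝ)) * r := by
        gcongr
        rcases le_total ‖x ν‖ₑ ‖y ν‖ₑ with h3 | h3
        · rw [max_eq_right h3]; exact h2.le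
        · rw [max_eq_left h3]; exact h1.le

theorem growthRate_zero {m : ℕ} : growthRate (0 : Set.Ici m → ℂ) = 0 := by
  have h : (fun ν : Set.Ici m => ‖(0 : Set.Ici m → ℂ) ν‖ₑ ^ (1 / (ν.1 : ℝ)))
      =ᶠ[atTop] fun _ => 0 := by
    filter_upwards [(tendsto_coe_Ici m).eventually (eventually_gt_atTop 0)] with ν hν
    have : (0 : ℝ) < 1 / (ν.1 : ℝ) := by positivity
    simp only [Pi.zero_apply, enorm_zero, ENNReal.zero_rpow_of_pos this]
  rw [growthRate, limsup_congr h, limsup_const]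

/-- The subspace `V_m^∧(ρ) = {y ∈ V_m : limsup |y(ν)|^{1/ν} ≤ ρ}` of `V_m`. -/
noncomputable def slowSubspace {n : ℕ} (a : Fin (n + 1) → ℕ → ℂ) (m : ℕ) (ρ : ℝ) :
    Submodule ℂ (Set.Ici m → ℂ) where
  carrier := {y | y ∈ solutionSpace a m ∧ growthRate y ≤ ENNReal.ofReal ρ}
  zero_mem' := ⟨zero_mem _, by rw [growthRate_zero]; exact zero_le⟩
  add_mem' := by
    rintro x y ⟨hx, hx'⟩ ⟨hy, hy'⟩
    refine ⟨add_mem hx hy, growthRate_le_of_le (C := 2) (by simp) (by simp) (fun ν => ?_) hx' hy'⟩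
    calc ‖(x + y) ν‖ₑ ≤ ‖x ν‖ₑ + ‖y ν‖ₑ := enorm_add_le _ _
      _ ≤ max ‖x ν‖ₑ ‖y ν‖ₑ + max ‖x ν‖ₑ ‖y ν‖ₑ :=
          add_le_add (le_max_left _ _) (le_max_right _ _)
      _ = 2 * max ‖x ν‖ₑ ‖y ν‖ₑ := (two_mul _).symm
  smul_mem' := by
    rintro c y ⟨hy, hy'⟩
    refine ⟨Submodule.smul_mem _ _ hy, growthRate_le_of_le (x := y) (C := ‖c‖ₑ + 1) (by simp)
      (by simp) (fun ν => ?_) hy' hy'⟩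
    rw [max_self, Pi.smul_apply, smul_eq_mul, enorm_mul]
    gcongr
    exact le_self_add

/-- `ω_{n,y}(ν) = max (|y(ν)|, …, |y(ν+n-1)|)`: the norm of `Fin n → ℂ` is the maximum of the
absolute values of the coordinates. -/
noncomputable def omega (n : ℕ) {m : ℕ} (y : Set.Ici m → ℂ) (ν : Set.Ici m) : ℝ :=
  ‖fun j : Fin n => y (shift ν j)‖

/-- The characteristic polynomial `T(z) = ∑_{k=0}^n ã_k z^k`. -/
noncomputable def charPoly {n : ℕ} (a' : Fin (n + 1) → ℂ) : Polynomial ℂ :=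
  ∑ k : Fin (n + 1), Polynomial.C (a' k) * Polynomial.X ^ (k : ℕ)

/-- The sum of the multiplicities of the roots of `T` of absolute value `r`. -/
noncomputable def multSum (T : Polynomial ℂ) (r : ℝ) : ℕ :=
  ∑ z ∈ T.roots.toFinset with ‖z‖ = r, T.rootMultiplicity z

/-- The maximum of the multiplicities of the roots of `T` of absolute value `r`
(`0` if there are none). -/
noncomputable def multMax (T : Polynomial ℂ) (r : ℝ) : ℕ :=
  {z ∈ T.roots.toFinset | ‖z‖ = r}.sup fun z => T.rootMultiplicity z

end PoincareDifference

namespace PoincareDifference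

/-! Split the roots of `T` into large ones, with `|z| ≥ r = ρ_θ`, and small ones, with `|z| ≤ r' =
ρ_{θ+1}`. For a root `z` of multiplicity `μ`, the sequences `x_j = act (coordPoly T z j) u`, `j <
μ`, are Jordan coordinates: `x_j(ν+1) = z x_j(ν) + x_{j+1}(ν)`, where `x_μ = act T u` measures how
far `u` is from solving the limiting recursion. For a solution this defect is `O(1/ν)` times the
window, and by partial fractions all the coordinates together control the window.

Give `x_j` the weight `t^j` with `t = (ν+1)^{1/k}`. The off-diagonal terms then contribute a
relative error `1/t`, and the defect contributes `t^{k-1}/(ν+1) = 1/t`: this choice of `t` balances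
the two. So the large part `p` is multiplied at each step by at least `r - O(1/t)`, up to `O(1/t)`
times the small part `q`, while `q` is multiplied by at most `r' + δ + O(1/t)`, up to `O(1/t)` times
`p` (`exists_weight_succ_bounds`). Once `q ≤ p` at a late index, this persists, and `p` grows like
`r^ν` up to the product of the factors `1 - O(ν^{-1/k})`, that is, up to `exp(-A (ln ν +
ν^{1-1/k}))` (`le_of_dominating`).

If `p ≤ q` held at all late indices, the solution would be `O(R^ν)` for an `R` below its growth
rate, so a solution outside the slow subspace eventually has `q < p`. At a fixed index this is an
open condition, so the bound holds near each such solution with common constants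
(`exists_nhds_lower_bound`). The solutions in `V` with initial window of norm `1` form a compact
set, which gives one constant for all of them; homogeneity does the rest. -/

/-! ### Jordan coordinates and partial fractions -/

open Polynomial in
/-- Polynomials act on sequences, the variable acting as the shift. -/
noncomputable def act (g : ℂ[X]) : (ℕ → ℂ) →ₗ[ℂ] (ℕ → ℂ) :=
  aeval (R := ℂ) (LinearMap.funLeft ℂ ℂ Nat.succ) g

theorem funLeft_succ_pow_apply (i : ℕ) (u : ℕ → ℂ) (ν : ℕ) :
    ((LinearMap.funLeft ℂ ℂ Nat.succ) ^ i) u ν = u (ν + i) := by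
  induction i generalizing ν with
  | zero => simp
  | succ i ih =>
    rw [pow_succ', Module.End.mul_apply, LinearMap.funLeft_apply, ih]
    congr 1
    omega

open Polynomial in
theorem act_apply {g : ℂ[X]} {N : ℕ} (hg : g.natDegree < N) (u : ℕ → ℂ) (ν : ℕ) :
    act g u ν = ∑ i ∈ Finset.range N, g.coeff i * u (ν + i) := by
  rw [act, aeval_eq_sum_range' hg, LinearMap.sum_apply, Finset.sum_apply]
  simp [funLeft_succ_pow_apply]

open Polynomial in
theorem act_X_pow (i : ℕ) (u : ℕ → ℂ) (ν : ℕ) : act (X ^ i) u ν = u (ν + i) := by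
  rw [act, map_pow, aeval_X, funLeft_succ_pow_apply]

-- Source of the Jordan block structure: with `coordPoly_succ`, the last term is the next coordinate
-- in the chain of `z`.
open Polynomial in
theorem act_apply_succ (z : ℂ) (g : ℂ[X]) (u : ℕ → ℂ) (ν : ℕ) :
    act g u (ν + 1) = z * act g u ν + act ((X - C z) * g) u ν := by
  have h : act ((X - C z) * g) u ν = act g u (ν + 1) - z * act g u ν := by
    rw [act, map_mul, Module.End.mul_apply]
    simp [act, LinearMap.funLeft_apply]
  rw [h]; ring

theorem act_add (g h : Polynomial ℂ) (u : ℕ → ℂ) (ν : ℕ) :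
    act (g + h) u ν = act g u ν + act h u ν := by
  simp [act]

theorem act_smul (c : ℂ) (g : Polynomial ℂ) (u : ℕ → ℂ) (ν : ℕ) :
    act (c • g) u ν = c * act g u ν := by
  simp [act]

theorem act_zero (u : ℕ → ℂ) (ν : ℕ) : act 0 u ν = 0 := by
  simp [act]

open Polynomial in
/-- The polynomials `(X - z)^j T / (X - z)^μ`, where `μ` is the multiplicity of the root `z`. -/
noncomputable def coordPoly (T : ℂ[X]) (z : ℂ) (j : ℕ) : ℂ[X] :=
  (X - C z) ^ j * ∏ w ∈ T.roots.toFinset \ {z}, (X - C w) ^ T.rootMultiplicity w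

open Polynomial in
theorem coordPoly_succ (T : ℂ[X]) (z : ℂ) (j : ℕ) :
    coordPoly T z (j + 1) = (X - C z) * coordPoly T z j := by
  rw [coordPoly, coordPoly, pow_succ', mul_assoc]

open Polynomial in
theorem prod_roots_eq {T : ℂ[X]} (hT : T.Monic) :
    ∏ w ∈ T.roots.toFinset, (X - C w) ^ T.rootMultiplicity w = T := by
  rw [← prod_multiset_root_eq_finset_root]
  have := (IsAlgClosed.splits T).eq_prod_roots
  rw [hT.leadingCoeff, C_1, one_mul] at this
  exact this.symm

open Polynomial in
theorem coordPoly_rootMultiplicity {T : ℂ[X]} (hT : T.Monic) {z : ℂ} (hz : z ∈ T.roots.toFinset) :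
    coordPoly T z (T.rootMultiplicity z) = T := by
  conv_rhs => rw [← prod_roots_eq hT]
  rw [coordPoly, Finset.sdiff_singleton_eq_erase, Finset.mul_prod_erase _
    (fun w => (X - C w) ^ T.rootMultiplicity w) hz]

open Polynomial in
theorem monic_coordPoly (T : ℂ[X]) (z : ℂ) (j : ℕ) : (coordPoly T z j).Monic :=
  ((monic_X_sub_C z).pow j).mul (monic_prod_of_monic _ _ fun w _ => (monic_X_sub_C w).pow _)

open Polynomial in
theorem natDegree_coordPoly_lt {T : ℂ[X]} (hT : T.Monic) {z : ℂ} (hz : z ∈ T.roots.toFinset)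
    {j : ℕ} (hj : j < T.rootMultiplicity z) : (coordPoly T z j).natDegree < T.natDegree := by
  have h : T = (X - C z) ^ (T.rootMultiplicity z - j) * coordPoly T z j := by
    conv_lhs => rw [← coordPoly_rootMultiplicity hT hz]
    rw [coordPoly, coordPoly, ← mul_assoc, ← pow_add, Nat.sub_add_cancel hj.le]
  have h2 := congrArg natDegree h
  rw [((monic_X_sub_C z).pow _).natDegree_mul (monic_coordPoly T z j), natDegree_pow,
    natDegree_X_sub_C] at h2
  omega

-- The powers belonging to distinct roots are pairwise coprime, so their complementary products
-- generate the unit ideal.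
open Polynomial in
theorem exists_sum_mul_coordPoly_eq_one (T : ℂ[X]) (h0 : T.roots.toFinset.Nonempty) :
    ∃ c : ℂ → ℂ[X], ∑ z ∈ T.roots.toFinset, c z * coordPoly T z 0 = 1 := by
  have hcop : Pairwise (Function.onFun IsCoprime
      fun w : T.roots.toFinset => (X - C (w : ℂ)) ^ T.rootMultiplicity (w : ℂ)) := fun v w hvw =>
    (isCoprime_X_sub_C_of_isUnit_sub
      (sub_ne_zero.2 fun h => hvw (Subtype.ext h)).isUnit).pow
  obtain ⟨c, hc⟩ := (exists_sum_eq_one_iff_pairwise_coprime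
    (s := fun w => (X - C w) ^ T.rootMultiplicity w) h0).2 hcop
  refine ⟨c, ?_⟩
  rw [← hc]
  exact Finset.sum_congr rfl fun z _ => by rw [coordPoly, pow_zero, one_mul]

open Polynomial in
/-- The span of the coordinate polynomials. -/
noncomputable def coordSpan (T : ℂ[X]) : Submodule ℂ ℂ[X] :=
  Submodule.span ℂ {h | ∃ z ∈ T.roots.toFinset, ∃ j < T.rootMultiplicity z, coordPoly T z j = h}

-- The Taylor expansion of `r` at `z` has the required coefficients.
open Polynomial in
theorem mul_coordPoly_mem_coordSpan {T : ℂ[X]} {z : ℂ} (hz : z ∈ T.roots.toFinset) {r : ℂ[X]}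
    (hr : r.natDegree < T.rootMultiplicity z) : r * coordPoly T z 0 ∈ coordSpan T := by
  rw [← sum_taylor_eq r z, Polynomial.sum_def, Finset.sum_mul]
  refine Submodule.sum_mem _ fun j hj => ?_
  have hj' : j < T.rootMultiplicity z := by
    refine lt_of_le_of_lt (le_natDegree_of_mem_supp j hj) ?_
    rwa [natDegree_taylor]
  have h2 : C ((taylor z r).coeff j) * (X - C z) ^ j * coordPoly T z 0
      = (taylor z r).coeff j • coordPoly T z j := by
    rw [smul_eq_C_mul, coordPoly, coordPoly, pow_zero, one_mul, mul_assoc]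
  rw [h2]
  exact Submodule.smul_mem _ _ (Submodule.subset_span ⟨z, hz, j, hj', rfl⟩)

open Polynomial in
theorem coordSpan_le_degreeLT {T : ℂ[X]} (hT : T.Monic) :
    coordSpan T ≤ degreeLT ℂ T.natDegree := by
  rw [coordSpan, Submodule.span_le]
  rintro _ ⟨z, hz, j, hj, rfl⟩
  rw [SetLike.mem_coe, mem_degreeLT]
  exact (degree_lt_iff_coeff_zero _ _).2 fun i hi =>
    coeff_eq_zero_of_natDegree_lt ((natDegree_coordPoly_lt hT hz hj).trans_le hi)

open Polynomial in
/-- Partial fractions: the coordinate polynomials span the polynomials of degree less than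
that of `T`. -/
theorem mem_coordSpan {T : ℂ[X]} (hT : T.Monic) {g : ℂ[X]} (hg : g ∈ degreeLT ℂ T.natDegree) :
    g ∈ coordSpan T := by
  rcases T.roots.toFinset.eq_empty_or_nonempty with h0 | h0
  · have h1 := prod_roots_eq hT
    rw [h0, Finset.prod_empty] at h1
    rw [← h1, natDegree_one, mem_degreeLT, Nat.cast_zero, Nat.WithBot.lt_zero_iff,
      degree_eq_bot] at hg
    rw [hg]; exact zero_mem _
  obtain ⟨c, hc⟩ := exists_sum_mul_coordPoly_eq_one T h0
  have hQ : ∀ z, ((X - C z) ^ T.rootMultiplicity z).Monic := fun z => (monic_X_sub_C z).pow _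
  have hTz : ∀ z ∈ T.roots.toFinset, (X - C z) ^ T.rootMultiplicity z * coordPoly T z 0 = T :=
    fun z hz => by
      conv_rhs => rw [← coordPoly_rootMultiplicity hT hz]
      rw [coordPoly, coordPoly, pow_zero, one_mul]
  have hg1 : g = T * ∑ z ∈ T.roots.toFinset, (g * c z) /ₘ (X - C z) ^ T.rootMultiplicity z
      + ∑ z ∈ T.roots.toFinset,
        ((g * c z) %ₘ (X - C z) ^ T.rootMultiplicity z) * coordPoly T z 0 := by
    rw [Finset.mul_sum, ← Finset.sum_add_distrib]
    calc g = ∑ z ∈ T.roots.toFinset, (g * c z) * coordPoly T z 0 := by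
          simp only [mul_assoc]
          rw [← Finset.mul_sum, hc, mul_one]
      _ = _ := Finset.sum_congr rfl fun z hz => by
          conv_lhs => rw [← modByMonic_add_div (g * c z) ((X - C z) ^ T.rootMultiplicity z)]
          rw [add_mul, mul_right_comm, hTz z hz, add_comm]
  have hsum : ∑ z ∈ T.roots.toFinset,
      ((g * c z) %ₘ (X - C z) ^ T.rootMultiplicity z) * coordPoly T z 0 ∈ coordSpan T := by
    refine Submodule.sum_mem _ fun z hz => mul_coordPoly_mem_coordSpan hz ?_
    have hpos : 0 < T.rootMultiplicity z := by
      rw [rootMultiplicity_pos hT.ne_zero]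
      exact (mem_roots hT.ne_zero).1 (Multiset.mem_toFinset.1 hz)
    have h1 := natDegree_modByMonic_lt (g * c z) (hQ z) (by
      intro h
      have := congrArg natDegree h
      rw [natDegree_pow, natDegree_X_sub_C, natDegree_one] at this
      omega)
    rwa [natDegree_pow, natDegree_X_sub_C, mul_one] at h1
  -- The difference of `g` and the remainder part is a multiple of `T` of degree less than that of
  -- `T`.
  have hz : ∑ z ∈ T.roots.toFinset, (g * c z) /ₘ (X - C z) ^ T.rootMultiplicity z = 0 := by
    by_contra hne
    have h1 := sub_mem hg (coordSpan_le_degreeLT hT hsum)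
    rw [← eq_sub_of_add_eq hg1.symm, mem_degreeLT, ← degree_eq_natDegree hT.ne_zero,
      degree_mul] at h1
    exact absurd h1 (not_lt.2 (le_add_of_nonneg_right (zero_le_degree_iff.2 hne)))
  rw [hz, mul_zero, zero_add] at hg1
  rw [hg1]
  exact hsum

/-! ### Weighted norms and their comparison with the window -/

/-- `max (|u(ν)|, …, |u(ν+n-1)|)`. -/
noncomputable def window (n : ℕ) (u : ℕ → ℂ) (ν : ℕ) : ℝ :=
  ‖fun j : Fin n => u (ν + j)‖

theorem window_nonneg (n : ℕ) (u : ℕ → ℂ) (ν : ℕ) : 0 ≤ window n u ν := norm_nonneg _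

theorem norm_le_window {n i : ℕ} (hi : i < n) (u : ℕ → ℂ) (ν : ℕ) :
    ‖u (ν + i)‖ ≤ window n u ν :=
  norm_le_pi_norm (fun j : Fin n => u (ν + j)) ⟨i, hi⟩

/-- A norm of the coordinates that belong to the roots in `S`, where the `j`-th coordinate in each
Jordan chain has weight `t ^ j`. -/
noncomputable def weight (T : Polynomial ℂ) (S : Finset ℂ) (t : ℝ) (u : ℕ → ℂ) (ν : ℕ) : ℝ :=
  ∑ z ∈ S, ∑ j ∈ Finset.range (T.rootMultiplicity z), t ^ j * ‖act (coordPoly T z j) u ν‖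

theorem weight_nonneg (T : Polynomial ℂ) (S : Finset ℂ) {t : ℝ} (ht : 0 ≤ t) (u : ℕ → ℂ) (ν : ℕ) :
    0 ≤ weight T S t u ν :=
  Finset.sum_nonneg fun _ _ => Finset.sum_nonneg fun _ _ => by positivity

theorem weight_mono (T : Polynomial ℂ) (S : Finset ℂ) {t t' : ℝ} (ht : 0 ≤ t) (h : t ≤ t')
    (u : ℕ → ℂ) (ν : ℕ) : weight T S t u ν ≤ weight T S t' u ν :=
  Finset.sum_le_sum fun _ _ => Finset.sum_le_sum fun _ _ => by gcongr

/-- One Jordan block: the off-diagonal term `t^j |x_{j+1}|` is `t⁻¹` times the next summand of the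
norm, except at the end of the chain, where `x_μ` lies outside the block. -/
theorem abs_sum_block_sub_le {t : ℝ} (ht : 1 ≤ t) {μ : ℕ} (hμ : 0 < μ) (z : ℂ) (x x' : ℕ → ℂ)
    (h : ∀ j < μ, x' j = z * x j + x (j + 1)) :
    |∑ j ∈ Finset.range μ, t ^ j * ‖x' j‖ - ‖z‖ * ∑ j ∈ Finset.range μ, t ^ j * ‖x j‖|
      ≤ t⁻¹ * ∑ j ∈ Finset.range μ, t ^ j * ‖x j‖ + t ^ (μ - 1) * ‖x μ‖ := by
  have ht0 : 0 < t := by linarith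
  obtain ⟨l, rfl⟩ : ∃ l, μ = l + 1 := ⟨μ - 1, by omega⟩
  have h1 : |∑ j ∈ Finset.range (l + 1), t ^ j * ‖x' j‖
      - ‖z‖ * ∑ j ∈ Finset.range (l + 1), t ^ j * ‖x j‖|
      ≤ ∑ j ∈ Finset.range (l + 1), t ^ j * ‖x (j + 1)‖ := by
    rw [Finset.mul_sum, ← Finset.sum_sub_distrib]
    refine (Finset.abs_sum_le_sum_abs _ _).trans (Finset.sum_le_sum fun j hj => ?_)
    have h2 : t ^ j * ‖x' j‖ - ‖z‖ * (t ^ j * ‖x j‖) = t ^ j * (‖x' j‖ - ‖z * x j‖) := by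
      rw [norm_mul]; ring
    rw [h2, abs_mul, abs_of_pos (pow_pos ht0 j)]
    gcongr
    refine (abs_norm_sub_norm_le _ _).trans (le_of_eq ?_)
    rw [h j (Finset.mem_range.1 hj), add_sub_cancel_left]
  refine h1.trans ?_
  rw [Finset.sum_range_succ, Finset.sum_range_succ' (fun j => t ^ j * ‖x j‖), Nat.add_sub_cancel,
    mul_add, Finset.mul_sum]
  have h3 : ∀ j, t⁻¹ * (t ^ (j + 1) * ‖x (j + 1)‖) = t ^ j * ‖x (j + 1)‖ := fun j => by
    rw [pow_succ]; field_simp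
  simp only [h3]
  have : 0 ≤ t⁻¹ * (t ^ 0 * ‖x 0‖) := by positivity
  linarith

theorem rootMultiplicity_pos_of_mem {T : Polynomial ℂ} (hT : T.Monic) {z : ℂ}
    (hz : z ∈ T.roots.toFinset) : 0 < T.rootMultiplicity z := by
  rw [Polynomial.rootMultiplicity_pos hT.ne_zero]
  exact (Polynomial.mem_roots hT.ne_zero).1 (Multiset.mem_toFinset.1 hz)

theorem abs_block_sub_le {T : Polynomial ℂ} (hT : T.Monic) {z : ℂ}
    (hz : z ∈ T.roots.toFinset) {t : ℝ} (ht : 1 ≤ t) {K : ℕ} (hK : T.rootMultiplicity z ≤ K)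
    (u : ℕ → ℂ) (ν : ℕ) :
    |∑ j ∈ Finset.range (T.rootMultiplicity z), t ^ j * ‖act (coordPoly T z j) u (ν + 1)‖ -
      ‖z‖ * ∑ j ∈ Finset.range (T.rootMultiplicity z), t ^ j * ‖act (coordPoly T z j) u ν‖|
      ≤ t⁻¹ * ∑ j ∈ Finset.range (T.rootMultiplicity z), t ^ j * ‖act (coordPoly T z j) u ν‖
        + t ^ (K - 1) * ‖act T u ν‖ := by
  refine (abs_sum_block_sub_le ht (rootMultiplicity_pos_of_mem hT hz) z
    (fun j => act (coordPoly T z j) u ν) (fun j => act (coordPoly T z j) u (ν + 1))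
    fun j _ => by rw [act_apply_succ z, coordPoly_succ]).trans ?_
  rw [coordPoly_rootMultiplicity hT hz]
  gcongr

theorem le_weight_succ {T : Polynomial ℂ} (hT : T.Monic) {S : Finset ℂ}
    (hS : S ⊆ T.roots.toFinset) {t : ℝ} (ht : 1 ≤ t) {K : ℕ}
    (hK : ∀ z ∈ S, T.rootMultiplicity z ≤ K) {r : ℝ} (hr : ∀ z ∈ S, r ≤ ‖z‖) (u : ℕ → ℂ) (ν : ℕ) :
    (r - t⁻¹) * weight T S t u ν - S.card * (t ^ (K - 1) * ‖act T u ν‖)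
      ≤ weight T S t u (ν + 1) := by
  have ht0 : 0 < t := by linarith
  rw [weight, weight, Finset.mul_sum, ← nsmul_eq_mul, ← Finset.sum_const, ← Finset.sum_sub_distrib]
  refine Finset.sum_le_sum fun z hz => ?_
  have h1 := (abs_le.1 (abs_block_sub_le hT (hS hz) ht (hK z hz) u ν)).1
  have h2 : 0 ≤ ∑ j ∈ Finset.range (T.rootMultiplicity z),
      t ^ j * ‖act (coordPoly T z j) u ν‖ := Finset.sum_nonneg fun _ _ => by positivity
  have h3 := mul_le_mul_of_nonneg_right (hr z hz) h2
  linarith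

theorem weight_succ_le {T : Polynomial ℂ} (hT : T.Monic) {S : Finset ℂ}
    (hS : S ⊆ T.roots.toFinset) {t : ℝ} (ht : 1 ≤ t) {K : ℕ}
    (hK : ∀ z ∈ S, T.rootMultiplicity z ≤ K) {r : ℝ} (hr : ∀ z ∈ S, ‖z‖ ≤ r) (u : ℕ → ℂ) (ν : ℕ) :
    weight T S t u (ν + 1)
      ≤ (r + t⁻¹) * weight T S t u ν + S.card * (t ^ (K - 1) * ‖act T u ν‖) := by
  have ht0 : 0 < t := by linarith
  rw [weight, weight, Finset.mul_sum, ← nsmul_eq_mul, ← Finset.sum_const, ← Finset.sum_add_distrib]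
  refine Finset.sum_le_sum fun z hz => ?_
  have h1 := (abs_le.1 (abs_block_sub_le hT (hS hz) ht (hK z hz) u ν)).2
  have h2 : 0 ≤ ∑ j ∈ Finset.range (T.rootMultiplicity z),
      t ^ j * ‖act (coordPoly T z j) u ν‖ := Finset.sum_nonneg fun _ _ => by positivity
  have h3 := mul_le_mul_of_nonneg_right (hr z hz) h2
  linarith

theorem exists_norm_act_le_weight {T g : Polynomial ℂ} (hg : g ∈ coordSpan T) :
    ∃ C : ℝ, 0 ≤ C ∧ ∀ u ν, ‖act g u ν‖ ≤ C * weight T T.roots.toFinset 1 u ν := by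
  rw [coordSpan] at hg
  induction hg using Submodule.span_induction with
  | mem g hg =>
    obtain ⟨z, hz, j, hj, rfl⟩ := hg
    refine ⟨1, zero_le_one, fun u ν => ?_⟩
    rw [one_mul, weight]
    refine le_trans ?_ (Finset.single_le_sum (fun _ _ => Finset.sum_nonneg fun _ _ => by
      positivity) hz)
    refine le_trans ?_ (Finset.single_le_sum (fun _ _ => by positivity) (Finset.mem_range.2 hj))
    rw [one_pow, one_mul]
  | zero => exact ⟨0, le_rfl, fun u ν => by rw [act_zero, norm_zero, zero_mul]⟩
  | add g h _ _ ihg ihh =>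
    obtain ⟨C, hC, h1⟩ := ihg
    obtain ⟨D, hD, h2⟩ := ihh
    refine ⟨C + D, add_nonneg hC hD, fun u ν => ?_⟩
    rw [act_add, add_mul]
    exact (norm_add_le _ _).trans (add_le_add (h1 u ν) (h2 u ν))
  | smul c g _ ih =>
    obtain ⟨C, hC, h1⟩ := ih
    refine ⟨‖c‖ * C, by positivity, fun u ν => ?_⟩
    rw [act_smul, norm_mul, mul_assoc]
    exact mul_le_mul_of_nonneg_left (h1 u ν) (norm_nonneg c)

theorem exists_window_le_weight {T : Polynomial ℂ} (hT : T.Monic) :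
    ∃ C : ℝ, 0 ≤ C ∧ ∀ u ν, window T.natDegree u ν ≤ C * weight T T.roots.toFinset 1 u ν := by
  have h : ∀ i : Fin T.natDegree, ∃ C : ℝ, 0 ≤ C ∧ ∀ u ν,
      ‖u (ν + i)‖ ≤ C * weight T T.roots.toFinset 1 u ν := fun i => by
    have hX : (Polynomial.X ^ (i : ℕ) : Polynomial ℂ) ∈ Polynomial.degreeLT ℂ T.natDegree := by
      rw [Polynomial.mem_degreeLT, Polynomial.degree_X_pow]
      exact_mod_cast i.2
    obtain ⟨C, hC, h1⟩ := exists_norm_act_le_weight (mem_coordSpan hT hX)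
    exact ⟨C, hC, fun u ν => by rw [← act_X_pow (i : ℕ) u ν]; exact h1 u ν⟩
  choose C hC h1 using h
  refine ⟨∑ i, C i, Finset.sum_nonneg fun i _ => hC i, fun u ν => ?_⟩
  have hw := weight_nonneg T T.roots.toFinset zero_le_one u ν
  refine (pi_norm_le_iff_of_nonneg (mul_nonneg (Finset.sum_nonneg fun i _ => hC i) hw)).2
    fun i => (h1 i u ν).trans ?_
  gcongr
  exact Finset.single_le_sum (fun i _ => hC i) (Finset.mem_univ i)

/-- `S` and `S'` need not be disjoint, since counting a root twice only increases the right side. -/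
theorem weight_roots_le (T : Polynomial ℂ) {S S' : Finset ℂ} (h : T.roots.toFinset ⊆ S ∪ S')
    {t t' : ℝ} (ht : 1 ≤ t) (ht' : 1 ≤ t') (u : ℕ → ℂ) (ν : ℕ) :
    weight T T.roots.toFinset 1 u ν ≤ weight T S t u ν + weight T S' t' u ν := by
  have h1 : weight T T.roots.toFinset 1 u ν ≤ weight T S 1 u ν + weight T S' 1 u ν := by
    have h0 : ∀ z : ℂ, 0 ≤ ∑ j ∈ Finset.range (T.rootMultiplicity z),
      (1 : ℝ) ^ j * ‖act (coordPoly T z j) u ν‖ := fun z => Finset.sum_nonneg fun _ _ => by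
        positivity
    rw [weight, weight, weight, ← Finset.sum_union_inter]
    exact (Finset.sum_le_sum_of_subset_of_nonneg h fun z _ _ => h0 z).trans
      (le_add_of_nonneg_right (Finset.sum_nonneg fun z _ => h0 z))
  exact h1.trans (add_le_add (weight_mono T S zero_le_one ht u ν)
    (weight_mono T S' zero_le_one ht' u ν))

theorem norm_act_le_window {g : Polynomial ℂ} {n : ℕ} (hg : g.natDegree < n) (u : ℕ → ℂ) (ν : ℕ) :
    ‖act g u ν‖ ≤ (∑ i ∈ Finset.range n, ‖g.coeff i‖) * window n u ν := by
  rw [act_apply hg, Finset.sum_mul]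
  refine (norm_sum_le _ _).trans (Finset.sum_le_sum fun i hi => ?_)
  rw [norm_mul]
  exact mul_le_mul_of_nonneg_left (norm_le_window (Finset.mem_range.1 hi) u ν) (norm_nonneg _)

theorem exists_weight_le_window {T : Polynomial ℂ} (hT : T.Monic) {S : Finset ℂ}
    (hS : S ⊆ T.roots.toFinset) {K : ℕ} (hK : ∀ z ∈ S, T.rootMultiplicity z ≤ K) :
    ∃ C : ℝ, 0 ≤ C ∧ ∀ t : ℝ, 1 ≤ t → ∀ u ν,
      weight T S t u ν ≤ C * (t ^ (K - 1) * window T.natDegree u ν) := by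
  refine ⟨∑ z ∈ S, ∑ j ∈ Finset.range (T.rootMultiplicity z),
    ∑ i ∈ Finset.range T.natDegree, ‖(coordPoly T z j).coeff i‖, Finset.sum_nonneg fun _ _ =>
      Finset.sum_nonneg fun _ _ => Finset.sum_nonneg fun _ _ => norm_nonneg _,
      fun t ht u ν => ?_⟩
  rw [weight, Finset.sum_mul]
  refine Finset.sum_le_sum fun z hz => ?_
  rw [Finset.sum_mul]
  refine Finset.sum_le_sum fun j hj => ?_
  have hj' := Finset.mem_range.1 hj
  have h1 := norm_act_le_window (natDegree_coordPoly_lt hT (hS hz) hj') u ν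
  have h2 : t ^ j ≤ t ^ (K - 1) := pow_le_pow_right₀ ht (by have := hK z hz; omega)
  rw [mul_left_comm]
  exact mul_le_mul h2 h1 (norm_nonneg _) (by positivity)

theorem continuous_act (g : Polynomial ℂ) (ν : ℕ) : Continuous fun u : ℕ → ℂ => act g u ν := by
  simp only [act_apply (Nat.lt_succ_self g.natDegree)]
  fun_prop

theorem continuous_weight (T : Polynomial ℂ) (S : Finset ℂ) (t : ℝ) (ν : ℕ) :
    Continuous fun u : ℕ → ℂ => weight T S t u ν := by
  have := fun g => continuous_act g ν
  unfold weight
  fun_prop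

/-! ### The scale and the accumulated loss -/

/-- The exponent `ln ν + ν^{1 - 1/k}` of the loss in the lower bound. -/
noncomputable def lossExponent (k ν : ℕ) : ℝ := Real.log ν + (ν : ℝ) ^ (1 - 1 / (k : ℝ))

/-- The scale `(ν + 1)^{1/k}`. -/
noncomputable def scale (k ν : ℕ) : ℝ := ((ν : ℝ) + 1) ^ (1 / (k : ℝ))

theorem one_le_scale (k ν : ℕ) : 1 ≤ scale k ν :=
  Real.one_le_rpow (by linarith [(Nat.cast_nonneg ν : (0 : ℝ) ≤ ν)]) (by positivity)

theorem scale_pow {k : ℕ} (hk : 1 ≤ k) (ν : ℕ) : scale k ν ^ k = (ν : ℝ) + 1 := by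
  rw [scale, one_div, Real.rpow_inv_natCast_pow (by positivity) (by omega)]

theorem scale_le_scale_succ (k ν : ℕ) : scale k ν ≤ scale k (ν + 1) := by
  unfold scale
  push_cast
  gcongr
  linarith

/-- The balance that dictates the scale: the weighted defect has the same order as the off-diagonal
terms. -/
theorem scale_pow_pred_div {k : ℕ} (hk : 1 ≤ k) (ν : ℕ) :
    scale k ν ^ (k - 1) / ((ν : ℝ) + 1) = (scale k ν)⁻¹ := by
  have h0 : scale k ν ≠ 0 := (zero_lt_one.trans_le (one_le_scale k ν)).ne'
  rw [← scale_pow hk ν]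
  obtain ⟨l, rfl⟩ : ∃ l, k = l + 1 := ⟨k - 1, by omega⟩
  rw [Nat.add_sub_cancel, pow_succ]
  field_simp

theorem one_div_le_scale_inv {k : ℕ} (hk : 1 ≤ k) (ν : ℕ) :
    1 / ((ν : ℝ) + 1) ≤ (scale k ν)⁻¹ := by
  rw [← scale_pow_pred_div hk ν]
  gcongr
  exact one_le_pow₀ (one_le_scale k ν)

theorem scale_pow_pred_le {k : ℕ} (hk : 1 ≤ k) (ν : ℕ) : scale k ν ^ (k - 1) ≤ (ν : ℝ) + 1 := by
  rw [← scale_pow hk ν]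
  exact pow_le_pow_right₀ (one_le_scale k ν) (Nat.sub_le k 1)

theorem tendsto_scale_inv {k : ℕ} (hk : 1 ≤ k) :
    Tendsto (fun ν => (scale k ν)⁻¹) atTop (𝓝 0) := by
  refine tendsto_inv_atTop_zero.comp ?_
  have hk' : (0 : ℝ) < 1 / (k : ℝ) := by positivity
  exact (tendsto_rpow_atTop hk').comp
    (tendsto_atTop_add_const_right _ 1 tendsto_natCast_atTop_atTop)

/-- The discrete form of bounding the sum of `ν^{-1/k}`. The power supplies the increment when `k ≥
2`, where `α ≥ 1/2`; for `k = 1` the power is constant and the logarithm supplies it. -/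
theorem lossExponent_add_le {k ν : ℕ} (hk : 1 ≤ k) (hν : 1 ≤ ν) :
    lossExponent k ν + (scale k ν)⁻¹ / 2 ≤ lossExponent k (ν + 1) := by
  have hx : (1 : ℝ) ≤ ν := by exact_mod_cast hν
  have hk1 : (1 : ℝ) ≤ k := by exact_mod_cast hk
  set x : ℝ := (ν : ℝ) with hxdef
  set α : ℝ := 1 - 1 / (k : ℝ) with hα
  have hα0 : 0 ≤ α := by
    rw [hα, sub_nonneg, div_le_one (by linarith)]; exact hk1
  have hα1 : α ≤ 1 := by
    rw [hα]; linarith [show (0 : ℝ) ≤ 1 / (k : ℝ) by positivity]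
  have hη : (scale k ν)⁻¹ = (x + 1) ^ α / (x + 1) := by
    rw [scale, ← Real.rpow_neg (by linarith), ← Real.rpow_sub_one (by linarith)]
    congr 1; rw [hα]; ring
  have h1 : x ^ α + α * (scale k ν)⁻¹ ≤ (x + 1) ^ α := by
    -- Bernoulli's inequality for an exponent in `[0, 1]`, applied to `x / (x + 1)`.
    have h2 := rpow_one_add_le_one_add_mul_self (s := -(1 / (x + 1)))
      (by rw [neg_le_neg_iff, div_le_one (by linarith)]; linarith) hα0 hα1
    have h3 : 1 + -(1 / (x + 1)) = x / (x + 1) := by field_simp; ring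
    rw [h3, Real.div_rpow (by linarith) (by linarith), div_le_iff₀ (by positivity)] at h2
    rw [hη]
    calc x ^ α + α * ((x + 1) ^ α / (x + 1))
        ≤ (1 + α * -(1 / (x + 1))) * (x + 1) ^ α + α * ((x + 1) ^ α / (x + 1)) := by linarith
      _ = (x + 1) ^ α := by ring
  have h4 : Real.log x + 1 / (x + 1) ≤ Real.log (x + 1) := by
    have h5 := Real.one_sub_inv_le_log_of_pos (x := (x + 1) / x) (by positivity)
    rw [Real.log_div (by linarith) (by linarith), inv_div] at h5
    have h6 : 1 - x / (x + 1) = 1 / (x + 1) := by field_simp; ring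
    linarith
  have hη0 : 0 ≤ (scale k ν)⁻¹ := by
    have := one_le_scale k ν
    positivity
  have h7 : (scale k ν)⁻¹ / 2 ≤ α * (scale k ν)⁻¹ + 1 / (x + 1) := by
    have h8 : 0 ≤ 1 / (x + 1) := by positivity
    rcases hk.eq_or_lt with rfl | hk2
    · have h9 : (scale 1 ν)⁻¹ = 1 / (x + 1) := by
        rw [hη, hα]; simp
      have h10 := mul_nonneg hα0 hη0
      linarith
    · have h9 : 1 / 2 ≤ α := by
        have : (2 : ℝ) ≤ k := by exact_mod_cast hk2
        have : 1 / (k : ℝ) ≤ 1 / 2 := by gcongr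
        rw [hα]; linarith
      nlinarith
  rw [lossExponent, lossExponent]
  push_cast
  rw [← hxdef, ← hα]
  linarith

theorem one_le_lossExponent {k ν : ℕ} (hk : 1 ≤ k) (hν : 1 ≤ ν) : 1 ≤ lossExponent k ν := by
  have hx : (1 : ℝ) ≤ ν := by exact_mod_cast hν
  have hk1 : (1 : ℝ) ≤ k := by exact_mod_cast hk
  have h1 : 1 / (k : ℝ) ≤ 1 := by rw [div_le_one (by linarith)]; exact hk1
  have h2 := Real.one_le_rpow hx (sub_nonneg.2 h1)
  have h3 := Real.log_nonneg hx
  rw [lossExponent]; linarith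

/-! ### Coupled inequalities and domination by the large roots -/

theorem exp_neg_two_mul_le_one_sub {x : ℝ} (hx0 : 0 ≤ x) (hx : x ≤ 1 / 2) :
    Real.exp (-(2 * x)) ≤ 1 - x := by
  rw [Real.exp_neg, inv_le_iff_one_le_mul₀ (Real.exp_pos _)]
  have h := Real.add_one_le_exp (2 * x)
  nlinarith

/-- Two interacting nonnegative sequences, of which the first one can grow faster: once the first
one dominates, it goes on dominating and growing. -/
theorem le_of_dominating {p q η h : ℕ → ℝ} {N : ℕ} {r r₀ D : ℝ} (hr₀ : 0 ≤ r₀) (hr : 0 < r)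
    (hD : 0 ≤ D) (hp0 : ∀ ν, 0 ≤ p ν) (hη0 : ∀ ν, 0 ≤ η ν)
    (hp : ∀ ν ≥ N, (r - D * η ν) * p ν - D * η ν * q ν ≤ p (ν + 1))
    (hq : ∀ ν ≥ N, q (ν + 1) ≤ (r₀ + D * η ν) * q ν + D * η ν * p ν)
    (hgap : ∀ ν ≥ N, r₀ + 4 * D * η ν ≤ r) (hh : ∀ ν ≥ N, h ν + η ν / 2 ≤ h (ν + 1))
    (hN : q N ≤ p N) {ν : ℕ} (hν : N ≤ ν) :
    q ν ≤ p ν ∧ p N * r ^ (ν - N) * Real.exp (-(8 * D / r) * (h ν - h N)) ≤ p ν := by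
  induction ν, hν using Nat.le_induction with
  | base => simp [hN]
  | succ ν hν ih =>
    obtain ⟨ih1, ih2⟩ := ih
    have hDη := mul_nonneg hD (hη0 ν)
    have hg := hgap ν hν
    have h1 : (r - 2 * (D * η ν)) * p ν ≤ p (ν + 1) := by
      have := mul_le_mul_of_nonneg_left ih1 hDη
      linarith [hp ν hν]
    refine ⟨?_, ?_⟩
    · have h2 : q (ν + 1) ≤ (r₀ + D * η ν) * p ν + D * η ν * p ν := by
        have := mul_le_mul_of_nonneg_left ih1 (add_nonneg hr₀ hDη)
        linarith [hq ν hν]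
      have h3 : (r₀ + 4 * D * η ν) * p ν ≤ r * p ν := mul_le_mul_of_nonneg_right hg (hp0 ν)
      linarith
    -- The step factor `1 - 2Dη/r` is at least `exp(-4Dη/r)`, and `η ν ≤ 2 (h (ν+1) - h ν)`; hence
    -- the constant `8D/r`.
    · have hx : 2 * (D * η ν) / r ≤ 1 / 2 := by
        rw [div_le_div_iff₀ hr two_pos]; linarith
      have hx0 : 0 ≤ 2 * (D * η ν) / r := by positivity
      have h2 := exp_neg_two_mul_le_one_sub hx0 hx
      have h3 : r * Real.exp (-(2 * (2 * (D * η ν) / r))) ≤ r - 2 * (D * η ν) := by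
        calc _ ≤ r * (1 - 2 * (D * η ν) / r) := mul_le_mul_of_nonneg_left h2 hr.le
          _ = _ := by field_simp
      have h4 : Real.exp (-(8 * D / r) * (h (ν + 1) - h N))
          ≤ Real.exp (-(8 * D / r) * (h ν - h N)) * Real.exp (-(2 * (2 * (D * η ν) / r))) := by
        rw [← Real.exp_add, Real.exp_le_exp]
        have h5 : 8 * D / r * (η ν / 2) ≤ 8 * D / r * (h (ν + 1) - h ν) :=
          mul_le_mul_of_nonneg_left (by linarith [hh ν hν]) (by positivity)
        have h6 : 8 * D / r * (η ν / 2) = 2 * (2 * (D * η ν) / r) := by ring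
        linarith
      rw [Nat.succ_sub hν, pow_succ]
      calc p N * (r ^ (ν - N) * r) * Real.exp (-(8 * D / r) * (h (ν + 1) - h N))
          ≤ p N * (r ^ (ν - N) * r) * (Real.exp (-(8 * D / r) * (h ν - h N))
            * Real.exp (-(2 * (2 * (D * η ν) / r)))) :=
            mul_le_mul_of_nonneg_left h4 (mul_nonneg (hp0 N) (by positivity))
        _ = (r * Real.exp (-(2 * (2 * (D * η ν) / r)))) *
            (p N * r ^ (ν - N) * Real.exp (-(8 * D / r) * (h ν - h N))) := by ring
        _ ≤ (r - 2 * (D * η ν)) * p ν := mul_le_mul h3 ih2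
            (mul_nonneg (mul_nonneg (hp0 N) (by positivity)) (Real.exp_pos _).le)
            (by linarith)
        _ ≤ p (ν + 1) := h1

theorem growthRate_le_of_le_geometric {m N : ℕ} {y : Set.Ici m → ℂ} {K R : ℝ} (hR : 0 ≤ R)
    (h : ∀ ν : Set.Ici m, N ≤ ν.1 → ‖y ν‖ ≤ K * R ^ ν.1) : growthRate y ≤ ENNReal.ofReal R := by
  -- A positive constant is needed for `L ^ (1/ν) → 1`.
  set L : ℝ := max K 1 with hL
  have hL0 : 0 < L := lt_max_of_lt_right one_pos
  have h0 : Tendsto (fun ν : Set.Ici m => 1 / (ν.1 : ℝ)) atTop (𝓝 0) :=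
    tendsto_one_div_atTop_nhds_zero_nat.comp (tendsto_coe_Ici m)
  have hlim : Tendsto (fun ν : Set.Ici m => ENNReal.ofReal (L ^ (1 / (ν.1 : ℝ)) * R)) atTop
      (𝓝 (ENNReal.ofReal (L ^ (0 : ℝ) * R))) :=
    ENNReal.tendsto_ofReal ((tendsto_const_nhds.rpow h0 (Or.inl hL0.ne')).mul_const R)
  rw [Real.rpow_zero, one_mul] at hlim
  rw [← hlim.limsup_eq, growthRate]
  refine limsup_le_limsup ?_
  filter_upwards [(tendsto_coe_Ici m).eventually (eventually_ge_atTop (N + 1))] with ν hν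
  have h1 : ‖y ν‖ ≤ L * R ^ ν.1 := (h ν (by omega)).trans (by gcongr; exact le_max_left _ _)
  have hp : (0 : ℝ) ≤ 1 / (ν.1 : ℝ) := by positivity
  rw [← ofReal_norm, ENNReal.ofReal_rpow_of_nonneg (norm_nonneg _) hp]
  refine ENNReal.ofReal_le_ofReal ((Real.rpow_le_rpow (norm_nonneg _) h1 hp).trans (le_of_eq ?_))
  rw [Real.mul_rpow hL0.le (by positivity), one_div (ν.1 : ℝ),
    Real.pow_rpow_inv_natCast hR (by omega)]

/-- The two inequalities that couple the coordinates belonging to the large roots and those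
belonging to the small roots. -/
theorem exists_weight_succ_bounds {T : Polynomial ℂ} (hT : T.Monic) {S S' : Finset ℂ}
    (hS : S ⊆ T.roots.toFinset) (hS' : S' ⊆ T.roots.toFinset) (hSS' : T.roots.toFinset ⊆ S ∪ S')
    {k : ℕ} (hk1 : 1 ≤ k) (hk : ∀ z ∈ S, T.rootMultiplicity z ≤ k) {r r' : ℝ}
    (hr : ∀ z ∈ S, r ≤ ‖z‖) (hr' : ∀ z ∈ S', ‖z‖ ≤ r') {δ : ℝ} (hδ : 0 < δ) {B : ℝ} (hB : 0 ≤ B) :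
    ∃ D : ℝ, 0 ≤ D ∧ ∃ d : ℝ, 1 ≤ d ∧ ∀ (u : ℕ → ℂ) (ν : ℕ),
      ‖act T u ν‖ ≤ B / ((ν : ℝ) + 1) * window T.natDegree u ν →
      (r - D * (scale k ν)⁻¹) * weight T S (scale k ν) u ν
          - D * (scale k ν)⁻¹ * weight T S' d u ν ≤ weight T S (scale k (ν + 1)) u (ν + 1) ∧
      weight T S' d u (ν + 1) ≤ (r' + δ + D * (scale k ν)⁻¹) * weight T S' d u ν
          + D * (scale k ν)⁻¹ * weight T S (scale k ν) u ν := by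
  obtain ⟨C, hC, hCw⟩ := exists_window_le_weight hT
  -- For the small roots a constant weight suffices: `d⁻¹ ≤ δ` puts the off-diagonal terms into the
  -- gap between `r'` and `r' + δ`.
  set d : ℝ := max 1 δ⁻¹ with hd
  have hd1 : 1 ≤ d := le_max_left _ _
  set K : ℕ := S'.sup fun z => T.rootMultiplicity z with hK
  set D₁ : ℝ := S.card * (B * C) with hD₁
  set D₂ : ℝ := S'.card * (d ^ (K - 1) * (B * C)) with hD₂
  have hD₁0 : 0 ≤ D₁ := by positivity
  have hD₂0 : 0 ≤ D₂ := by positivity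
  refine ⟨1 + D₁ + D₂, by positivity, d, hd1, fun u ν hu => ?_⟩
  have ht1 := one_le_scale k ν
  set t := scale k ν with ht
  set p := weight T S t u ν with hp
  set q := weight T S' d u ν with hq
  have hp0 : 0 ≤ p := weight_nonneg T S (by linarith) u ν
  have hq0 : 0 ≤ q := weight_nonneg T S' (by linarith) u ν
  have ht0 : 0 < t⁻¹ := by positivity
  have hu' : ‖act T u ν‖ ≤ B * C * (p + q) * (1 / ((ν : ℝ) + 1)) := by
    refine hu.trans ?_
    calc B / ((ν : ℝ) + 1) * window T.natDegree u ν
        ≤ B / ((ν : ℝ) + 1) * (C * (p + q)) := by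
          refine mul_le_mul_of_nonneg_left ((hCw u ν).trans ?_) (by positivity)
          exact mul_le_mul_of_nonneg_left (weight_roots_le T hSS' ht1 hd1 u ν) hC
      _ = _ := by ring
  constructor
  · have h1 := le_weight_succ hT hS ht1 hk hr u ν
    -- The weight grows with `ν`, which is harmless in a lower bound.
    have h2 := weight_mono T S (by linarith) (scale_le_scale_succ k ν) u (ν + 1)
    have h3 : S.card * (t ^ (k - 1) * ‖act T u ν‖) ≤ D₁ * t⁻¹ * (p + q) := by
      calc S.card * (t ^ (k - 1) * ‖act T u ν‖)
          ≤ S.card * (t ^ (k - 1) * (B * C * (p + q) * (1 / ((ν : ℝ) + 1)))) := by gcongr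
        _ = D₁ * (t ^ (k - 1) / ((ν : ℝ) + 1)) * (p + q) := by rw [hD₁]; ring
        _ = _ := by rw [ht, scale_pow_pred_div hk1]
    have h4 : 0 ≤ D₂ * t⁻¹ * p := by positivity
    have h5 : 0 ≤ (1 + D₂) * t⁻¹ * q := by positivity
    linarith
  · have h1 := weight_succ_le hT hS' hd1
      (fun z hz => Finset.le_sup (f := fun z => T.rootMultiplicity z) hz) hr' u ν
    have h3 : S'.card * (d ^ (K - 1) * ‖act T u ν‖) ≤ D₂ * t⁻¹ * (p + q) := by
      calc S'.card * (d ^ (K - 1) * ‖act T u ν‖)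
          ≤ S'.card * (d ^ (K - 1) * (B * C * (p + q) * t⁻¹)) := by
            gcongr
            refine hu'.trans ?_
            gcongr
            exact one_div_le_scale_inv hk1 ν
        _ = _ := by rw [hD₂]; ring
    have h4 : 0 ≤ (1 + D₁) * t⁻¹ * p := by positivity
    have h5 : 0 ≤ (1 + D₁) * t⁻¹ * q := by positivity
    have h6 : d⁻¹ * q ≤ δ * q := by
      refine mul_le_mul_of_nonneg_right ?_ hq0
      rw [inv_le_comm₀ (by linarith) hδ]
      exact le_max_right _ _
    linarith

/-- Near a sequence that does not grow slowly, all solutions of a perturbed recursion with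
characteristic polynomial `T` have a common lower bound from some index on. -/
theorem exists_nhds_lower_bound {T : Polynomial ℂ} (hT : T.Monic) {S S' : Finset ℂ}
    (hS : S ⊆ T.roots.toFinset) (hS' : S' ⊆ T.roots.toFinset) (hSS' : T.roots.toFinset ⊆ S ∪ S')
    {k : ℕ} (hk1 : 1 ≤ k) (hk : ∀ z ∈ S, T.rootMultiplicity z ≤ k) {r r' R : ℝ}
    (hr : ∀ z ∈ S, r ≤ ‖z‖) (hr' : ∀ z ∈ S', ‖z‖ ≤ r') (h0r' : 0 ≤ r') (hR' : r' < R) (hR : R < r)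
    {B : ℝ} (hB : 0 ≤ B) {m : ℕ} (hm : 1 ≤ m) {E : Set (ℕ → ℂ)}
    (hE : ∀ u ∈ E, ∀ ν ≥ m, ‖act T u ν‖ ≤ B / ((ν : ℝ) + 1) * window T.natDegree u ν)
    {u₀ : ℕ → ℂ} (hu₀ : u₀ ∈ E)
    (hgrow : ∀ N K, ∃ ν ≥ N, K * R ^ ν < window T.natDegree u₀ ν) :
    ∃ N ≥ m, ∃ U ∈ 𝓝 u₀, ∃ c > 0, ∃ A : ℝ, 0 ≤ A ∧ ∀ u ∈ U, u ∈ E → ∀ ν ≥ N,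
      c * r ^ ν * Real.exp (-A * lossExponent k ν) ≤ window T.natDegree u ν := by
  set δ : ℝ := (R - r') / 2 with hδ
  have hδ0 : 0 < δ := by rw [hδ]; linarith
  have hr0 : 0 < r := by linarith
  have hR0 : 0 < R := by linarith
  obtain ⟨D, hD, d, hd, hstep⟩ := exists_weight_succ_bounds hT hS hS' hSS' hk1 hk hr hr' hδ0 hB
  obtain ⟨C, hC, hCw⟩ := exists_window_le_weight hT
  obtain ⟨C', hC', hCw'⟩ := exists_weight_le_window hT hS hk
  have hη0 : ∀ ν, 0 ≤ (scale k ν)⁻¹ := fun ν =>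
    inv_nonneg.2 (zero_le_one.trans (one_le_scale k ν))
  have hlim : Tendsto (fun ν => 4 * D * (scale k ν)⁻¹) atTop (𝓝 0) := by
    simpa using (tendsto_scale_inv hk1).const_mul (4 * D)
  obtain ⟨N₀, hN₀⟩ := eventually_atTop.1 (hlim.eventually (eventually_lt_nhds hδ0))
  have hp0 : ∀ (u : ℕ → ℂ) ν, 0 ≤ weight T S (scale k ν) u ν := fun u ν =>
    weight_nonneg T S (zero_le_one.trans (one_le_scale k ν)) u ν
  have hq0 : ∀ (u : ℕ → ℂ) ν, 0 ≤ weight T S' d u ν := fun u ν =>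
    weight_nonneg T S' (zero_le_one.trans hd) u ν
  -- Otherwise `p ≤ q` from `max m N₀` on; then `q` grows at most by the factor `r' + δ + 2Dη ≤ R`,
  -- and the window, at most `C (p + q) ≤ 2 C q`, is `O(R^ν)`, contrary to `hgrow`.
  obtain ⟨N, hN, hdom⟩ : ∃ N ≥ max m N₀, weight T S' d u₀ N < weight T S (scale k N) u₀ N := by
    by_contra! hcon
    set N₁ := max m N₀ with hN₁
    have hq : ∀ ν ≥ N₁, weight T S' d u₀ ν ≤ weight T S' d u₀ N₁ * R ^ (ν - N₁) := by
      intro ν hν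
      induction ν, hν using Nat.le_induction with
      | base => simp
      | succ ν hν ih =>
        have h1 := (hstep u₀ ν (hE u₀ hu₀ ν ((le_max_left _ _).trans hν))).2
        have h2 := hN₀ ν ((le_max_right _ _).trans hν)
        have h3 := mul_le_mul_of_nonneg_left (hcon ν hν) (mul_nonneg hD (hη0 ν))
        have h4 : (r' + δ + 2 * (D * (scale k ν)⁻¹)) * weight T S' d u₀ ν
            ≤ R * weight T S' d u₀ ν := by
          refine mul_le_mul_of_nonneg_right ?_ (hq0 u₀ ν)
          have := mul_nonneg hD (hη0 ν)
          rw [hδ] at h2 ⊢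
          linarith
        rw [Nat.succ_sub hν, pow_succ]
        have h5 := mul_le_mul_of_nonneg_left ih hR0.le
        linarith
    obtain ⟨ν, hν, hlt⟩ := hgrow N₁ (2 * C * weight T S' d u₀ N₁ / R ^ N₁)
    have h1 := (hCw u₀ ν).trans (mul_le_mul_of_nonneg_left
      (weight_roots_le T hSS' (one_le_scale k ν) hd u₀ ν) hC)
    have h2 := hcon ν hν
    have h3 : window T.natDegree u₀ ν ≤ C * (2 * (weight T S' d u₀ N₁ * R ^ (ν - N₁))) :=
      h1.trans (mul_le_mul_of_nonneg_left (by linarith [hq ν hν]) hC)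
    have h4 : 2 * C * weight T S' d u₀ N₁ / R ^ N₁ * R ^ ν
        = C * (2 * (weight T S' d u₀ N₁ * R ^ (ν - N₁))) := by
      rw [pow_sub₀ R hR0.ne' hν]; ring
    linarith
  have hNm : m ≤ N := (le_max_left _ _).trans hN
  set p₀ := weight T S (scale k N) u₀ N with hp₀
  have hp₀pos : 0 < p₀ := (hq0 u₀ N).trans_lt hdom
  refine ⟨N, hNm, {u | weight T S' d u N < weight T S (scale k N) u N} ∩
    {u | p₀ / 2 < weight T S (scale k N) u N}, ?_, p₀ / (4 * (C' + 1) * r ^ N), by positivity,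
    8 * D / r + 1, by positivity, ?_⟩
  -- The weights at the fixed index `N` involve finitely many terms of the sequence, so both strict
  -- inequalities are open in the product topology.
  · exact ((isOpen_lt (continuous_weight T S' d N) (continuous_weight T S _ N)).inter
      (isOpen_lt continuous_const (continuous_weight T S _ N))).mem_nhds
        ⟨hdom, by rw [Set.mem_ofPred_eq]; linarith⟩
  rintro u ⟨hu1, hu2⟩ huE ν hν
  rw [Set.mem_ofPred_eq] at hu1 hu2
  have hν1 : 1 ≤ ν := hm.trans (hNm.trans hν)
  have hmain := (le_of_dominating (p := fun ν => weight T S (scale k ν) u ν)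
    (q := fun ν => weight T S' d u ν) (η := fun ν => (scale k ν)⁻¹) (h := lossExponent k) (N := N)
    (r := r) (r₀ := r' + δ) (D := D) (by linarith) hr0 hD (hp0 u) hη0
    (fun ν hν => (hstep u ν (hE u huE ν (hNm.trans hν))).1)
    (fun ν hν => (hstep u ν (hE u huE ν (hNm.trans hν))).2)
    (fun ν hν => by
      have := hN₀ ν ((le_max_right _ _).trans (hN.trans hν))
      rw [hδ] at this ⊢
      linarith)
    (fun ν hν => lossExponent_add_le hk1 (hm.trans (hNm.trans hν))) hu1.le hν).2
  -- Returning from the weighted norm to the window costs `t^{k-1} ≤ ν + 1`, which the logarithm in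
  -- `lossExponent` absorbs at the price of `1` in the constant `A`.
  have hup : weight T S (scale k ν) u ν
      ≤ (C' + 1) * (2 * Real.exp (lossExponent k ν) * window T.natDegree u ν) := by
    have hν1' : (1 : ℝ) ≤ ν := by exact_mod_cast hν1
    have h1 : scale k ν ^ (k - 1) ≤ 2 * Real.exp (lossExponent k ν) := by
      have h2 : (ν : ℝ) ≤ Real.exp (lossExponent k ν) := by
        rw [← Real.log_le_iff_le_exp (by linarith), lossExponent]
        exact le_add_of_nonneg_right (Real.rpow_nonneg (by linarith) _)
      linarith [scale_pow_pred_le hk1 ν]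
    have hw := window_nonneg T.natDegree u ν
    refine (hCw' _ (one_le_scale k ν) u ν).trans ?_
    exact mul_le_mul (by linarith) (mul_le_mul_of_nonneg_right h1 hw)
      (mul_nonneg (pow_nonneg (zero_le_one.trans (one_le_scale k ν)) _) hw) (by linarith)
  have hexp : Real.exp (-(8 * D / r) * lossExponent k ν)
      ≤ Real.exp (-(8 * D / r) * (lossExponent k ν - lossExponent k N)) := by
    rw [Real.exp_le_exp]
    have h1 := mul_nonneg (show 0 ≤ 8 * D / r by positivity)
      (zero_le_one.trans (one_le_lossExponent hk1 (hm.trans hNm)))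
    linarith
  have hlow : p₀ / 2 * r ^ (ν - N) * Real.exp (-(8 * D / r) * lossExponent k ν)
      ≤ (C' + 1) * (2 * Real.exp (lossExponent k ν) * window T.natDegree u ν) := by
    refine le_trans ?_ (hmain.trans hup)
    have hrN : 0 ≤ r ^ (ν - N) := pow_nonneg hr0.le _
    exact mul_le_mul (mul_le_mul_of_nonneg_right hu2.le hrN) hexp (Real.exp_pos _).le
      (mul_nonneg (hp0 u N) hrN)
  have hsplit : Real.exp (-(8 * D / r + 1) * lossExponent k ν)
      = Real.exp (-(8 * D / r) * lossExponent k ν) / Real.exp (lossExponent k ν) := by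
    rw [← Real.exp_sub]; congr 1; ring
  rw [hsplit]
  have h1 : p₀ / (4 * (C' + 1) * r ^ N) * r ^ ν * (Real.exp (-(8 * D / r) * lossExponent k ν)
      / Real.exp (lossExponent k ν)) = (p₀ / 2 * r ^ (ν - N) *
        Real.exp (-(8 * D / r) * lossExponent k ν)) /
          ((C' + 1) * (2 * Real.exp (lossExponent k ν))) := by
    rw [pow_sub₀ r hr0.ne' hν]
    field_simp
    ring
  rw [h1, div_le_iff₀ (by positivity)]
  linarith

/-! ### Solutions of the recursion and uniform bounds near them -/

/-- Extension of a sequence by zero. -/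
noncomputable def extend {m : ℕ} (y : Set.Ici m → ℂ) (ν : ℕ) : ℂ :=
  if h : m ≤ ν then y ⟨ν, h⟩ else 0

theorem continuous_extend (m : ℕ) : Continuous (extend : (Set.Ici m → ℂ) → ℕ → ℂ) := by
  refine continuous_pi fun ν => ?_
  unfold extend
  split_ifs
  · exact continuous_apply _
  · exact continuous_const

theorem extend_shift {m : ℕ} (y : Set.Ici m → ℂ) (ν : Set.Ici m) (i : ℕ) :
    extend y (ν.1 + i) = y (shift ν i) :=
  dif_pos (shift ν i).2

theorem window_extend (n : ℕ) {m : ℕ} (y : Set.Ici m → ℂ) (ν : Set.Ici m) :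
    window n (extend y) ν.1 = omega n y ν := by
  rw [window, omega]
  simp only [extend_shift]

theorem monic_charPoly {n : ℕ} {a' : Fin (n + 1) → ℂ} (h : a' (Fin.last n) = 1) :
    (charPoly a').Monic ∧ (charPoly a').natDegree = n := by
  have h1 : charPoly a' = Polynomial.X ^ n + ∑ i : Fin n,
      Polynomial.C (a' i.castSucc) * Polynomial.X ^ (i : ℕ) := by
    rw [charPoly, Fin.sum_univ_castSucc, h]
    simp [add_comm]
  have hdeg := Polynomial.degree_sum_fin_lt fun i : Fin n => a' i.castSucc
  rw [h1]
  refine ⟨Polynomial.monic_X_pow_add hdeg, ?_⟩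
  rw [Polynomial.natDegree_add_eq_left_of_degree_lt (by rwa [Polynomial.degree_X_pow]),
    Polynomial.natDegree_X_pow]

theorem act_charPoly {n : ℕ} (a' : Fin (n + 1) → ℂ) (u : ℕ → ℂ) (ν : ℕ) :
    act (charPoly a') u ν = ∑ i : Fin (n + 1), a' i * u (ν + i) := by
  rw [act, charPoly, map_sum, LinearMap.sum_apply, Finset.sum_apply]
  simp [funLeft_succ_pow_apply]

/-- A solution of the recursion with vanishing initial values vanishes. -/
theorem eq_zero_of_omega_eq_zero {n : ℕ} {a : Fin (n + 1) → ℕ → ℂ}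
    (ha_last : ∀ ν, a (Fin.last n) ν = 1) {m : ℕ} {y : Set.Ici m → ℂ}
    (hy : y ∈ solutionSpace a m) (h : ∀ j < n, y (shift ⟨m, Set.mem_Ici.2 le_rfl⟩ j) = 0) :
    y = 0 := by
  have key : ∀ j, y (shift ⟨m, Set.mem_Ici.2 le_rfl⟩ j) = 0 := by
    intro j
    induction j using Nat.strong_induction_on with
    | _ j ih =>
      rcases lt_or_ge j n with hj | hj
      · exact h j hj
      · have h1 := hy (shift ⟨m, Set.mem_Ici.2 le_rfl⟩ (j - n))
        have hs : ∀ i, shift (shift (⟨m, Set.mem_Ici.2 le_rfl⟩ : Set.Ici m) (j - n)) i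
            = shift ⟨m, Set.mem_Ici.2 le_rfl⟩ (j - n + i) := fun i =>
          Subtype.ext (Nat.add_assoc _ _ _)
        rw [Fin.sum_univ_castSucc, ha_last, one_mul, Finset.sum_eq_zero, zero_add, hs,
          Fin.val_last, Nat.sub_add_cancel hj] at h1
        · exact h1
        · intro i _
          rw [hs, ih _ (by have := i.2; simp only [Fin.val_castSucc]; omega), mul_zero]
  funext ν
  have h1 : shift ⟨m, Set.mem_Ici.2 le_rfl⟩ (ν.1 - m) = ν :=
    Subtype.ext (Nat.add_sub_cancel' ν.2)
  rw [← h1, key]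
  rfl

/-- Solutions of the recursion nearly solve the limiting recursion with constant coefficients,
and their size increases at most geometrically. -/
theorem exists_solution_bounds {n : ℕ} {a : Fin (n + 1) → ℕ → ℂ} {a' : Fin (n + 1) → ℂ}
    (ha_last : ∀ ν, a (Fin.last n) ν = 1) (ha'_last : a' (Fin.last n) = 1)
    {c : ℝ} (hc : 0 ≤ c) (ha : ∀ i ν, ‖a i ν - a' i‖ ≤ c * (1 / ((ν : ℝ) + 1))) (m : ℕ) :
    ∃ B : ℝ, 0 ≤ B ∧ ∃ M : ℝ, 1 ≤ M ∧ ∀ y ∈ solutionSpace a m, ∀ ν ≥ m,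
      ‖act (charPoly a') (extend y) ν‖ ≤ B / ((ν : ℝ) + 1) * window n (extend y) ν ∧
      window n (extend y) (ν + 1) ≤ M * window n (extend y) ν := by
  refine ⟨n * c, by positivity, 1 + ∑ i : Fin n, (‖a' i.castSucc‖ + c), ?_, ?_⟩
  · exact le_add_of_nonneg_right (Finset.sum_nonneg fun i _ => by positivity)
  intro y hy ν hν
  have h1 : ∑ i : Fin (n + 1), a i ν * extend y (ν + i) = 0 := by
    have := hy ⟨ν, hν⟩
    simpa only [← extend_shift] using this
  have hw := window_nonneg n (extend y) ν
  constructor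
  -- Both leading coefficients are `1`, so the term `i = n` cancels and the window of length `n`
  -- bounds the rest.
  · have h2 : act (charPoly a') (extend y) ν
        = ∑ i : Fin n, (a' i.castSucc - a i.castSucc ν) * extend y (ν + i) := by
      rw [act_charPoly, ← sub_zero (∑ i : Fin (n + 1), a' i * extend y (ν + i)), ← h1,
        ← Finset.sum_sub_distrib, Fin.sum_univ_castSucc, ha_last, ha'_last, sub_self, add_zero]
      simp only [sub_mul, Fin.val_castSucc]
    rw [h2]
    refine (norm_sum_le _ _).trans ((Finset.sum_le_sum (g := fun _ =>
      c * (1 / ((ν : ℝ) + 1)) * window n (extend y) ν) fun i _ => ?_).trans (le_of_eq ?_))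
    · rw [norm_mul, norm_sub_rev]
      exact mul_le_mul (ha _ _) (norm_le_window i.2 _ _) (norm_nonneg _) (by positivity)
    · rw [Finset.sum_const, Finset.card_univ, Fintype.card_fin, nsmul_eq_mul]; ring
  · have h3 : ‖extend y (ν + n)‖
        ≤ (∑ i : Fin n, (‖a' i.castSucc‖ + c)) * window n (extend y) ν := by
      rw [Fin.sum_univ_castSucc, ha_last, one_mul, Fin.val_last, add_comm] at h1
      rw [eq_neg_of_add_eq_zero_left h1, norm_neg, Finset.sum_mul]
      refine (norm_sum_le _ _).trans (Finset.sum_le_sum fun i _ => ?_)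
      rw [norm_mul]
      refine mul_le_mul ?_ (norm_le_window i.2 _ _) (norm_nonneg _) (by positivity)
      have h4 : c * (1 / ((ν : ℝ) + 1)) ≤ c := by
        refine mul_le_of_le_one_right hc ?_
        rw [div_le_one (by positivity)]
        linarith [(Nat.cast_nonneg ν : (0 : ℝ) ≤ ν)]
      have h5 := norm_add_le (a' i.castSucc) (a i.castSucc ν - a' i.castSucc)
      rw [add_sub_cancel] at h5
      linarith [ha i.castSucc ν]
    have h6 : 0 ≤ (∑ i : Fin n, (‖a' i.castSucc‖ + c)) * window n (extend y) ν :=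
      mul_nonneg (Finset.sum_nonneg fun i _ => by positivity) hw
    rw [add_mul, one_mul]
    refine (pi_norm_le_iff_of_nonneg (by positivity)).2 fun i => ?_
    rcases Nat.lt_or_ge (i + 1) n with hi | hi
    · have := norm_le_window hi (extend y) ν
      rw [add_assoc, add_comm 1]
      linarith
    · have hin : ν + 1 + i = ν + n := by have := i.2; omega
      rw [hin]
      linarith

theorem rootMultiplicity_le_multMax {T : Polynomial ℂ} {z : ℂ} (hz : z ∈ T.roots.toFinset) :
    T.rootMultiplicity z ≤ multMax T ‖z‖ :=
  Finset.le_sup (f := fun z => T.rootMultiplicity z) (Finset.mem_filter.2 ⟨hz, rfl⟩)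

theorem mul_pow_le_pow_mul_of_succ_le {w : ℕ → ℝ} {M : ℝ} (hM : 0 ≤ M) {m : ℕ}
    (hw : ∀ ν ≥ m, w (ν + 1) ≤ M * w ν) {ν N : ℕ} (hν : m ≤ ν) (hN : ν ≤ N) :
    w N ≤ M ^ (N - ν) * w ν := by
  induction N, hN using Nat.le_induction with
  | base => simp
  | succ N hN ih =>
    rw [Nat.succ_sub hN, pow_succ', mul_assoc]
    exact (hw N (hν.trans hN)).trans (mul_le_mul_of_nonneg_left ih hM)

/-- A lower bound that holds from some index on extends to all indices. -/
theorem exists_exp_lower_bound {k m N : ℕ} (hk : 1 ≤ k) (hm : 1 ≤ m) {c r A M : ℝ}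
    (hc : 0 < c) (hr : 0 < r) (hA : 0 ≤ A) (hM : 1 ≤ M) :
    ∃ A' : ℝ, 0 < A' ∧ ∀ w : ℕ → ℝ, (∀ ν ≥ m, w (ν + 1) ≤ M * w ν) → (∀ ν, 0 ≤ w ν) →
      (∀ ν ≥ N, c * r ^ ν * Real.exp (-A * lossExponent k ν) ≤ w ν) →
      ∀ ν ≥ m, Real.exp (-A' * lossExponent k ν) * r ^ ν ≤ w ν := by
  -- Carries the bound at `N` back to `ν < N`: each step multiplies `w` by at most `M`, and `max 1 r
  -- ^ N` dominates `r ^ ν`.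
  set c₁ : ℝ := c * r ^ N * Real.exp (-A * lossExponent k N) / (M ^ N * max 1 r ^ N) with hc₁
  have hM0 : 0 < M := by linarith
  have hmax : 0 < max 1 r := lt_max_of_lt_left one_pos
  have hc₁0 : 0 < c₁ := by positivity
  set c₂ := min c c₁ with hc₂
  have hc₂0 : 0 < c₂ := lt_min hc hc₁0
  refine ⟨A + |Real.log c₂| + 1, by positivity, fun w hw hw0 hbound ν hν => ?_⟩
  have hL := one_le_lossExponent hk (hm.trans hν)
  -- Since `lossExponent` is at least `1`, a constant factor can be moved into the exponent.
  have hfac : Real.exp (-(A + |Real.log c₂| + 1) * lossExponent k ν)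
      ≤ c₂ * Real.exp (-A * lossExponent k ν) := by
    conv_rhs => rw [← Real.exp_log hc₂0]
    rw [← Real.exp_add, Real.exp_le_exp]
    have h1 := neg_abs_le (Real.log c₂)
    have h2 : |Real.log c₂| ≤ |Real.log c₂| * lossExponent k ν :=
      le_mul_of_one_le_right (abs_nonneg _) hL
    linarith
  have hrν : 0 < r ^ ν := pow_pos hr ν
  refine (mul_le_mul_of_nonneg_right hfac hrν.le).trans ?_
  rcases le_or_gt N ν with h | h
  · refine le_trans ?_ (hbound ν h)
    rw [mul_right_comm]
    gcongr
    exact min_le_left _ _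
  · have h1 := (hbound N le_rfl).trans (mul_pow_le_pow_mul_of_succ_le hM0.le hw hν h.le)
    have h2 : M ^ (N - ν) * w ν ≤ M ^ N * w ν :=
      mul_le_mul_of_nonneg_right (pow_le_pow_right₀ hM (Nat.sub_le _ _)) (hw0 ν)
    have h3 : r ^ ν ≤ max 1 r ^ N :=
      (pow_le_pow_left₀ hr.le (le_max_right _ _) ν).trans
        (pow_le_pow_right₀ (le_max_left _ _) h.le)
    have h4 : Real.exp (-A * lossExponent k ν) ≤ 1 := by
      rw [Real.exp_le_one_iff]
      have := mul_nonneg hA (zero_le_one.trans hL)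
      linarith
    have h5 : c₁ * max 1 r ^ N ≤ w ν := by
      rw [hc₁, div_mul_eq_mul_div, div_le_iff₀ (by positivity)]
      have := mul_le_mul_of_nonneg_right (h1.trans h2) (pow_pos hmax N).le
      linarith
    calc c₂ * Real.exp (-A * lossExponent k ν) * r ^ ν ≤ c₁ * 1 * max 1 r ^ N := by
          gcongr
          exact min_le_right _ _
      _ ≤ w ν := by rwa [mul_one]

/-- The initial values `y(m), …, y(m+n-1)`. -/
def initialValues (n m : ℕ) : (Set.Ici m → ℂ) →ₗ[ℂ] (Fin n → ℂ) where
  toFun y j := y (shift ⟨m, Set.mem_Ici.2 le_rfl⟩ j)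
  map_add' _ _ := rfl
  map_smul' _ _ := rfl

theorem omega_smul (n : ℕ) {m : ℕ} (c : ℂ) (y : Set.Ici m → ℂ) (ν : Set.Ici m) :
    omega n (c • y) ν = ‖c‖ * omega n y ν := by
  rw [omega, omega, ← norm_smul]
  rfl

/-- The set of solutions in `V` with initial values of size `1` is compact. -/
theorem isCompact_setOf_omega_eq_one {n m : ℕ} {a : Fin (n + 1) → ℕ → ℂ}
    (ha_last : ∀ ν, a (Fin.last n) ν = 1) {V : Submodule ℂ (Set.Ici m → ℂ)}
    (hV : V ≤ solutionSpace a m) :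
    IsCompact {y : V | omega n (y : Set.Ici m → ℂ) ⟨m, Set.mem_Ici.2 le_rfl⟩ = 1} := by
  set L : V →ₗ[ℂ] (Fin n → ℂ) := (initialValues n m).domRestrict V with hL
  have hker : LinearMap.ker L = ⊥ := by
    refine LinearMap.ker_eq_bot'.2 fun y hy => Subtype.ext ?_
    exact eq_zero_of_omega_eq_zero ha_last (hV y.2) fun j hj => congrFun hy ⟨j, hj⟩
  have hfin : FiniteDimensional ℂ V :=
    Module.Finite.of_injective L (LinearMap.ker_eq_bot.1 hker)
  -- Initial values embed the finite-dimensional `V` as a closed subspace of `ℂ^n`; the set is the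
  -- preimage of the unit sphere.
  have hcomp := (LinearMap.isClosedEmbedding_of_injective hker).isCompact_preimage
    (isCompact_sphere (0 : Fin n → ℂ) 1)
  convert hcomp using 1
  ext y
  rw [Set.mem_preimage, mem_sphere_zero_iff_norm]
  rfl

/-- The lower bound near a solution of fast growth. -/
theorem exists_nhds_exp_lower_bound {n : ℕ} (hn : 1 ≤ n) {a : Fin (n + 1) → ℕ → ℂ}
    {a' : Fin (n + 1) → ℂ} (ha_last : ∀ ν, a (Fin.last n) ν = 1)
    (ha'_last : a' (Fin.last n) = 1) {c : ℝ} (hc : 0 ≤ c)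
    (ha : ∀ i ν, ‖a i ν - a' i‖ ≤ c * (1 / ((ν : ℝ) + 1))) {r r' : ℝ} (h0r' : 0 ≤ r')
    (hrr' : r' < r) (hgap : ∀ z ∈ (charPoly a').roots.toFinset, r ≤ ‖z‖ ∨ ‖z‖ ≤ r') {k : ℕ}
    (hk1 : 1 ≤ k)
    (hk : ∀ z ∈ (charPoly a').roots.toFinset, r ≤ ‖z‖ → (charPoly a').rootMultiplicity z ≤ k)
    {m : ℕ} (hm : 1 ≤ m) {y₀ : Set.Ici m → ℂ} (hy₀ : y₀ ∈ solutionSpace a m)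
    (hslow : y₀ ∉ slowSubspace a m r') :
    ∃ U ∈ 𝓝 y₀, ∃ A : ℝ, 0 < A ∧ ∀ y ∈ U, y ∈ solutionSpace a m → ∀ ν : Set.Ici m,
      Real.exp (-A * lossExponent k ν.1) * r ^ ν.1 ≤ omega n y ν := by
  obtain ⟨hmonic, hdeg⟩ := monic_charPoly ha'_last
  have hgrow : ENNReal.ofReal r' < growthRate y₀ := by
    by_contra! h
    exact hslow ⟨hy₀, h⟩
  -- `R` lies strictly between `r'` and both `r` and the growth rate of `y₀`.
  obtain ⟨b, hb1, hb2⟩ := exists_between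
    (lt_min hgrow ((ENNReal.ofReal_lt_ofReal_iff (h0r'.trans_lt hrr')).2 hrr'))
  obtain ⟨hb3, hb4⟩ := lt_min_iff.1 hb2
  set R := b.toReal with hR
  have hbR : b = ENNReal.ofReal R := (ENNReal.ofReal_toReal hb4.ne_top).symm
  have hR' : r' < R := by
    rw [hbR] at hb1
    exact (ENNReal.ofReal_lt_ofReal_iff_of_nonneg h0r').1 hb1
  have hRr : R < r := by
    rw [hbR] at hb4
    exact (ENNReal.ofReal_lt_ofReal_iff (h0r'.trans_lt hrr')).1 hb4
  obtain ⟨B, hB, M, hM, hbd⟩ := exists_solution_bounds ha_last ha'_last hc ha m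
  obtain ⟨N, -, U, hU, c', hc', A, hA, hlow⟩ := exists_nhds_lower_bound hmonic
    (S := {z ∈ (charPoly a').roots.toFinset | r ≤ ‖z‖})
    (S' := {z ∈ (charPoly a').roots.toFinset | ‖z‖ ≤ r'})
    (Finset.filter_subset _ _) (Finset.filter_subset _ _)
    (fun z hz => by
      rw [Finset.mem_union, Finset.mem_filter, Finset.mem_filter]
      exact (hgap z hz).imp (⟨hz, ·⟩) (⟨hz, ·⟩))
    hk1 (fun z hz => hk z (Finset.mem_filter.1 hz).1 (Finset.mem_filter.1 hz).2)
    (fun z hz => (Finset.mem_filter.1 hz).2) (fun z hz => (Finset.mem_filter.1 hz).2)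
    h0r' hR' hRr hB hm (E := extend '' {y | y ∈ solutionSpace a m})
    (by
      rintro _ ⟨y, hy, rfl⟩ ν hν
      rw [hdeg]
      exact (hbd y hy ν hν).1)
    (u₀ := extend y₀) ⟨y₀, hy₀, rfl⟩
    (by
      by_contra! h
      obtain ⟨N, K, h⟩ := h
      rw [hbR] at hb3
      refine absurd hb3 (not_lt.2 (growthRate_le_of_le_geometric (N := N) (K := K)
        (h0r'.trans hR'.le) fun ν hν => (le_trans ?_ (h ν.1 hν))))
      have := norm_le_window (n := n) (i := 0) hn (extend y₀) ν.1
      rw [extend_shift] at this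
      rw [hdeg]
      exact this)
  obtain ⟨A', hA', hfin⟩ := exists_exp_lower_bound (k := k) hk1 hm hc' (h0r'.trans_lt hrr') hA hM
  refine ⟨extend ⁻¹' U, (continuous_extend m).continuousAt hU, A', hA', fun y hy hsol ν => ?_⟩
  rw [← window_extend]
  refine hfin (window n (extend y)) (fun ν hν => (hbd y hsol ν hν).2)
    (fun ν => window_nonneg n _ ν) (fun ν hν => ?_) ν.1 ν.2
  have := hlow (extend y) hy ⟨y, hsol, rfl⟩ ν hν
  rwa [hdeg] at this

/-! ### Reduction of the hypotheses and conclusion by compactness -/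

theorem multMax_pos_of_multSum_pos {T : Polynomial ℂ} {r : ℝ} (h : 0 < multSum T r) :
    0 < multMax T r := by
  rw [multSum] at h
  obtain ⟨z, hz, hpos⟩ := Finset.exists_ne_zero_of_sum_ne_zero h.ne'
  exact (Nat.pos_of_ne_zero hpos).trans_le (Finset.le_sup (f := fun z => T.rootMultiplicity z) hz)

/-- The comparison function never vanishes, so the asymptotic bound holds at every index after
enlarging the constant. -/
theorem exists_uniform_bound {ι : Type*} [Fintype ι] {f : ι → ℕ → ℂ}
    (h : ∀ i, f i =O[atTop] fun ν : ℕ => 1 / ((ν : ℝ) + 1)) :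
    ∃ c : ℝ, 0 ≤ c ∧ ∀ i ν, ‖f i ν‖ ≤ c * (1 / ((ν : ℝ) + 1)) := by
  choose C hC0 hC using fun i => Asymptotics.bound_of_isBigO_nat_atTop (h i)
  refine ⟨∑ i, C i, Finset.sum_nonneg fun i _ => (hC0 i).le, fun i ν => ?_⟩
  have h0 : 0 < 1 / ((ν : ℝ) + 1) := by positivity
  have h1 := hC i h0.ne'
  rw [Real.norm_of_nonneg h0.le] at h1
  refine h1.trans ?_
  gcongr
  exact Finset.single_le_sum (fun i _ => (hC0 i).le) (Finset.mem_univ i)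

theorem eq_one_of_norm_one_sub_le {x : ℂ} {c : ℝ}
    (h : ∀ ν : ℕ, ‖1 - x‖ ≤ c * (1 / ((ν : ℝ) + 1))) : x = 1 := by
  have hlim : Tendsto (fun ν : ℕ => c * (1 / ((ν : ℝ) + 1))) atTop (𝓝 (c * 0)) :=
    tendsto_one_div_add_atTop_nhds_zero_nat.const_mul c
  rw [mul_zero] at hlim
  have := ge_of_tendsto' hlim h
  exact (sub_eq_zero.1 (norm_le_zero_iff.1 this)).symm

end PoincareDifference

open PoincareDifference in
/-- The moduli `ρ_1 > … > ρ_{s+1} = 0` are indexed by `Fin (s + 1)`, and `θ ∈ {1, …, s}` by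
`Fin s`: then `ρ_θ` is `ρ θ.castSucc` and `ρ_{θ+1}` is `ρ θ.succ`. -/
theorem theorem10 (s n : ℕ) (hn : 1 ≤ n)
    (a : Fin (n + 1) → ℕ → ℂ) (a' : Fin (n + 1) → ℂ)
    (ha_last : ∀ ν : ℕ, a (Fin.last n) ν = 1)
    (ha : ∀ i : Fin (n + 1),
      (fun ν : ℕ => a i ν - a' i) =O[Filter.atTop] fun ν : ℕ => 1 / ((ν : ℝ) + 1))
    (ρ : Fin (s + 1) → ℝ) (hρ : StrictAnti ρ) (hρ_last : ρ (Fin.last s) = 0)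
    (hroots : ∀ z : ℂ, (PoincareDifference.charPoly a').IsRoot z → ∃ i, ‖z‖ = ρ i)
    (he : ∀ i : Fin s,
      0 < PoincareDifference.multSum (PoincareDifference.charPoly a') (ρ i.castSucc))
    (k : ℕ)
    (hk : k = Finset.univ.sup fun i : Fin s =>
      PoincareDifference.multMax (PoincareDifference.charPoly a') (ρ i.castSucc))
    (m : ℕ) (hm : 1 ≤ m) (θ : Fin s)
    (V : Submodule ℂ (Set.Ici m → ℂ)) (hV : V ≤ PoincareDifference.solutionSpace a m)
    (hVθ : V ⊓ PoincareDifference.slowSubspace a m (ρ θ.succ) = ⊥) :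
    ∃ A : ℝ, 0 < A ∧ ∀ y ∈ V, ∀ ν : Set.Ici m,
      Real.exp (-A * (Real.log ((ν : ℕ) : ℝ) + ((ν : ℕ) : ℝ) ^ (1 - 1 / (k : ℝ))))
          * ρ θ.castSucc ^ (ν : ℕ) * PoincareDifference.omega n y ⟨m, Set.mem_Ici.2 le_rfl⟩
        ≤ PoincareDifference.omega n y ν := by
  obtain ⟨c, hc, hac⟩ := exists_uniform_bound ha
  have ha'_last : a' (Fin.last n) = 1 := eq_one_of_norm_one_sub_le (c := c) fun ν => by
    have := hac (Fin.last n) ν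
    rwa [ha_last] at this
  obtain ⟨hmonic, hdeg⟩ := monic_charPoly ha'_last
  have hrr' : ρ θ.succ < ρ θ.castSucc := hρ Fin.castSucc_lt_succ
  have h0r' : 0 ≤ ρ θ.succ := hρ_last ▸ hρ.antitone (Fin.le_last _)
  have hmult : ∀ i : Fin s, multMax (charPoly a') (ρ i.castSucc) ≤ k := fun i => hk ▸
    Finset.le_sup (f := fun i : Fin s => multMax (charPoly a') (ρ i.castSucc)) (Finset.mem_univ i)
  have hk1 : 1 ≤ k := (multMax_pos_of_multSum_pos (he θ)).trans_le (hmult θ)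
  have hroot : ∀ z ∈ (charPoly a').roots.toFinset, ∃ i, ‖z‖ = ρ i := fun z hz =>
    hroots z ((Polynomial.mem_roots hmonic.ne_zero).1 (Multiset.mem_toFinset.1 hz))
  have hgap : ∀ z ∈ (charPoly a').roots.toFinset, ρ θ.castSucc ≤ ‖z‖ ∨ ‖z‖ ≤ ρ θ.succ := by
    intro z hz
    obtain ⟨i, hi⟩ := hroot z hz
    rw [hi]
    rcases le_or_gt i θ.castSucc with h | h
    · exact Or.inl (hρ.antitone h)
    · exact Or.inr (hρ.antitone (Fin.castSucc_lt_iff_succ_le.1 h))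
  have hkz : ∀ z ∈ (charPoly a').roots.toFinset, ρ θ.castSucc ≤ ‖z‖ →
      (charPoly a').rootMultiplicity z ≤ k := by
    intro z hz hzr
    obtain ⟨i, hi⟩ := hroot z hz
    rw [hi, hρ.le_iff_ge] at hzr
    -- The root `0` is not among the large roots, so its multiplicity does not enter `k`.
    have hi' : i ≠ Fin.last s := (hzr.trans_lt (Fin.castSucc_lt_last θ)).ne
    obtain ⟨j, rfl⟩ := Fin.exists_castSucc_eq.2 hi'
    have := rootMultiplicity_le_multMax hz
    rw [hi] at this
    exact this.trans (hmult j)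
  obtain ⟨A, hA, hAV⟩ : ∃ A : ℝ, 0 < A ∧
      ∀ y ∈ {y : V | omega n (y : Set.Ici m → ℂ) ⟨m, Set.mem_Ici.2 le_rfl⟩ = 1},
        ∀ ν : Set.Ici m, Real.exp (-A * lossExponent k ν.1) * ρ θ.castSucc ^ ν.1
          ≤ omega n (y : Set.Ici m → ℂ) ν := by
    -- Having a common constant passes to subsets and finite unions, so it is enough to have it near
    -- each point.
    refine (isCompact_setOf_omega_eq_one ha_last hV).induction_on
      (p := fun s => ∃ A : ℝ, 0 < A ∧ ∀ y ∈ s, ∀ ν : Set.Ici m,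
        Real.exp (-A * lossExponent k ν.1) * ρ θ.castSucc ^ ν.1
          ≤ omega n (y : Set.Ici m → ℂ) ν) ?_ ?_ ?_ ?_
    · exact ⟨1, one_pos, fun y hy => absurd hy (Set.notMem_empty y)⟩
    · rintro s t hst ⟨A, hA, h⟩
      exact ⟨A, hA, fun y hy => h y (hst hy)⟩
    · rintro s t ⟨A, hA, h⟩ ⟨A', hA', h'⟩
      have hmono : ∀ ν : Set.Ici m, ∀ D ≤ max A A',
          Real.exp (-max A A' * lossExponent k ν.1) * ρ θ.castSucc ^ ν.1
            ≤ Real.exp (-D * lossExponent k ν.1) * ρ θ.castSucc ^ ν.1 := fun ν D hD => by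
        have hL := one_le_lossExponent hk1 (hm.trans ν.2)
        have hρ0 : 0 ≤ ρ θ.castSucc := h0r'.trans hrr'.le
        gcongr
      refine ⟨max A A', lt_max_of_lt_left hA, fun y hy ν => ?_⟩
      rcases hy with hy | hy
      · exact (hmono ν A (le_max_left _ _)).trans (h y hy ν)
      · exact (hmono ν A' (le_max_right _ _)).trans (h' y hy ν)
    · intro y hy
      have hslow : (y : Set.Ici m → ℂ) ∉ slowSubspace a m (ρ θ.succ) := by
        intro hmem
        have h0 : (y : Set.Ici m → ℂ) ∈ V ⊓ slowSubspace a m (ρ θ.succ) := ⟨y.2, hmem⟩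
        rw [hVθ, Submodule.mem_bot] at h0
        have h1 := omega_smul n 0 (y : Set.Ici m → ℂ) ⟨m, Set.mem_Ici.2 le_rfl⟩
        rw [zero_smul, norm_zero, zero_mul] at h1
        rw [Set.mem_ofPred_eq, h0, h1] at hy
        exact zero_ne_one hy
      obtain ⟨U, hU, A, hA, h⟩ := exists_nhds_exp_lower_bound hn ha_last ha'_last hc hac h0r' hrr'
        hgap hk1 hkz hm (hV y.2) hslow
      exact ⟨Subtype.val ⁻¹' U, mem_nhdsWithin_of_mem_nhds
        (continuous_subtype_val.continuousAt hU), A, hA, fun w hw ν => h w hw (hV w.2) ν⟩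
  refine ⟨A, hA, fun y hy ν => ?_⟩
  change Real.exp (-A * lossExponent k ν.1) * ρ θ.castSucc ^ ν.1 * _ ≤ _
  set ω₀ := omega n y ⟨m, Set.mem_Ici.2 le_rfl⟩ with hω₀
  -- For `ω₀ = 0` the left side vanishes; otherwise `y` is rescaled to initial size `1`.
  rcases (show 0 ≤ ω₀ from norm_nonneg _).eq_or_lt with h0 | h0
  · rw [← h0, mul_zero]
    exact norm_nonneg _
  · have hnorm : ‖((ω₀⁻¹ : ℝ) : ℂ)‖ = ω₀⁻¹ := by
      rw [Complex.norm_real, Real.norm_of_nonneg (inv_nonneg.2 h0.le)]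
    have h1 := hAV ⟨((ω₀⁻¹ : ℝ) : ℂ) • y, V.smul_mem _ hy⟩ (by
      rw [Set.mem_ofPred_eq, omega_smul, hnorm, ← hω₀, inv_mul_cancel₀ h0.ne']) ν
    rw [omega_smul, hnorm] at h1
    rwa [← le_div_iff₀ h0, div_eq_inv_mul]
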